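/- **Conventions.** Compact spaces are Hausdorff, $C(K)$ is the real Banach space of continuous functions on $K$ with the supremum norm, and $\mathrm{Ext}(Z,Y)=0$ means that every twisted sum of $Y$ and $Z$ is trivial: for every short exact sequence $0\to Y\to X\to Z\to 0$ of Banach spaces and bounded operators, the map $Y\to X$ has a bounded left inverse. A family $\mathcal A$ of infinite subsets of $\omega$ is almost disjoint if $A\cap B$ is finite for all distinct $A,B\in\mathcal A$. Families $\mathcal A_1,\dots,\mathcal A_n$ of subsets of $\omega$ are separated if there are $S_1,\dots,S_n\subseteq\omega$ with $\bigcap_{i=1}^n S_i=\emptyset$ such that $A\setminus S_i$ is finite for every $i\le n$ and every $A\in\mathcal A_i$. For $n\ge 2$, $\mathfrak a_n$ is the minimal cardinality of an almost disjoint family that can be divided into $n$ pairwise disjoint parts that are not separated, and $\mathfrak a_\omega=\sup_{n\ge 2}\mathfrak a_n$. By $\mathbb A(\kappa)$ we denote the one-point compactification of a discrete space of cardinality $\kappa$. Finally, $\mathcal E$ is the $\sigma$-ideal of those subsets of $2^\omega$ that can be covered by countably many closed sets that are null for the standard product measure, and $\mathrm{non}(\mathcal E)$ is the least cardinality of a subset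 of $2^\omega$ that is not in $\mathcal E$. **Theorem.** Let $K$ be a compact space. 1. Suppose that for every $n\ge 2$ there are $F_1,\dots,F_n\subseteq K$, each homeomorphic to $\mathbb A(\mathfrak a_n)$, such that, if $z_i$ is the only cluster point of $F_i$, then there are pairwise disjoint open sets $V_1,\dots,V_n\subseteq K$ with $F_i\setminus\{z_i\}\subseteq V_i$ for all $i\le n$. Then $\mathrm{Ext}(C(K),c_0)\ne 0$. 2. If for every $n\ge 2$ the space $K$ contains $n$ pairwise disjoint copies of $\mathbb A(\mathfrak a_n)$, then $\mathrm{Ext}(C(K),c_0)\neq 0$. 3. If $\kappa\ge\mathfrak a_\omega$ is a cardinal and $K$ contains a copy of the Cantor cube $2^\kappa$, then $\mathrm{Ext}(C(K),c_0)\ne 0$. 4. In particular, if $2^{\mathfrak c}$ embeds into $K$, then $\mathrm{Ext}(C(K),c_0)\neq0$. 5. Moreover, $\omega_1\le\mathfrak a_\omega\le\mathrm{non}(\mathcal E)$. Hence, if $\mathrm{non}(\mathcal E)=\omega_1$, then part 3 applies with $\kappa=\omega_1$. -/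

import Mathlib

open Cardinal Topology MeasureTheory
open scoped ZeroAtInfty

universe u v

/-! ### Twisted sums -/

/-- `ExtEqZero Z Y` says that every twisted sum of the Banach spaces `Y` and `Z`, that is, every short
exact sequence `0 → Y → X → Z → 0` of Banach spaces and bounded operators, is trivial: the map
`Y → X` has a bounded left inverse. The space `X` of such a sequence is in bijection with `Y × Z`,
so that no generality is lost by the choice of its universe. -/
def ExtEqZero (Z : Type u) (Y : Type v) [NormedAddCommGroup Z] [NormedSpace ℝ Z]
    [NormedAddCommGroup Y] [NormedSpace ℝ Y] : Prop :=
  ∀ (X : Type (max u v)) [NormedAddCommGroup X] [NormedSpace ℝ X] [CompleteSpace X]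
    (j : Y →L[ℝ] X) (q : X →L[ℝ] Z),
    Function.Injective j → Function.Surjective q → (∀ x : X, q x = 0 ↔ x ∈ Set.range j) →
      ∃ r : X →L[ℝ] Y, ∀ y : Y, r (j y) = y

/-! ### Almost disjoint families and the cardinals `𝔞_n`, `𝔞_ω` -/

/-- Almost disjoint families of infinite subsets of `ℕ`. -/
def IsAlmostDisjointFamily (𝒜 : Set (Set ℕ)) : Prop :=
  (∀ A ∈ 𝒜, A.Infinite) ∧ ∀ A ∈ 𝒜, ∀ B ∈ 𝒜, A ≠ B → (A ∩ B).Finite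

/-- The families `P 0, …, P (n - 1)` of subsets of `ℕ` are separated: there are sets
`S 0, …, S (n - 1)` with empty intersection such that each member of `P i` is contained in `S i`
up to a finite set. -/
def FamiliesSeparated {n : ℕ} (P : Fin n → Set (Set ℕ)) : Prop :=
  ∃ S : Fin n → Set ℕ, (⋂ i, S i) = ∅ ∧ ∀ i, ∀ A ∈ P i, (A \ S i).Finite

/-- For `2 ≤ n`, the cardinal `𝔞_n`: the least cardinality of an almost disjoint family that can be
divided into `n` pairwise disjoint parts that are not separated. -/
noncomputable def cardA (n : ℕ) : Cardinal.{0} :=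
  sInf {κ : Cardinal.{0} | ∃ 𝒜 : Set (Set ℕ), IsAlmostDisjointFamily 𝒜 ∧ #𝒜 = κ ∧
    ∃ P : Fin n → Set (Set ℕ), (∀ i j, i ≠ j → Disjoint (P i) (P j)) ∧ (⋃ i, P i) = 𝒜 ∧
      ¬ FamiliesSeparated P}

/-- `𝔞_ω`, the supremum of the cardinals `𝔞_n` over `2 ≤ n`. -/
noncomputable def cardAOmega : Cardinal.{0} :=
  ⨆ n : {n : ℕ // 2 ≤ n}, cardA n

/-! ### One-point compactifications of discrete spaces -/

/-- The discrete space of cardinality `κ`. -/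
def DiscreteOfCard (κ : Cardinal.{u}) : Type u := κ.out

instance (κ : Cardinal.{u}) : TopologicalSpace (DiscreteOfCard κ) := ⊥

instance (κ : Cardinal.{u}) : DiscreteTopology (DiscreteOfCard κ) := ⟨rfl⟩

/-- `𝔸(κ)`, the one-point compactification of a discrete space of cardinality `κ`. -/
abbrev AleksandrovSpace (κ : Cardinal.{u}) : Type u := OnePoint (DiscreteOfCard κ)

/-! ### The ideal `ℰ` on the Cantor set -/

/-- The standard product probability measure on the Cantor set `2^ω`. -/
noncomputable def cantorMeasure : Measure (ℕ → Bool) :=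
  Measure.infinitePi fun _ : ℕ => (PMF.uniformOfFintype Bool).toMeasure

/-- The σ-ideal `ℰ` of the subsets of `2^ω` that can be covered by countably many closed sets of
measure zero. -/
def InIdealE (X : Set (ℕ → Bool)) : Prop :=
  ∃ C : ℕ → Set (ℕ → Bool), (∀ k, IsClosed (C k) ∧ cantorMeasure (C k) = 0) ∧ X ⊆ ⋃ k, C k

/-- `non(ℰ)`, the least cardinality of a subset of `2^ω` that is not in `ℰ`. -/
noncomputable def nonE : Cardinal.{0} :=
  sInf {κ : Cardinal.{0} | ∃ X : Set (ℕ → Bool), ¬ InIdealE X ∧ #X = κ}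

/-! A weak*-null family of functionals `φ a` on `Z`, indexed by an almost disjoint family `A a`,
yields a twisted sum of `c₀` and `Z`: the pairs `(f, g)` where `g` tends to `φ a f` along each `A a`
and is small off finite unions of the `A a`. If `Ext(Z, c₀) = 0`, it splits, and
`exists_lift_of_extEqZero` gives a bounded linear lift `s : Z → ℓ_∞`.

For `Z = C(K)`, take for each `m` an unseparated family in `n = (m + 2)²` parts, and attach to the
members of part `i` the functionals `(m + 2)⁻¹ (δ_x - δ_{z_i})`, with distinct points `x ∈ V_i`
converging to `z_i`. Let `S_i` be the set of `k` at which `s f` exceeds `(m + 2)⁻¹ / 2` for some `f`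
in the unit ball vanishing off `V_i`. By Urysohn, `S_i` almost contains the members of part `i`. At
a common point of the `S_i`, the sum of the `n` witnesses has norm at most `1`, while its lift is at
least `(m + 2) / 2` there. For large `m` this exceeds the norm of `s`, so the `S_i` separate the
parts, a contradiction (`not_extEqZero_of_tendsto`).

The lower bound on `𝔞_ω` comes from separating countable families; the upper bound from a prediction
argument on branches of the binary tree (`exists_not_familiesSeparated_of_not_inIdealE`). -/

open Filter BoundedContinuousFunction

/-! ### Lifting functionals along an almost disjoint family -/

/-- The pairs `(f, g)` such that `g` converges to `φ a f` along each `A a` and is small off finite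
unions of the sets `A a`. -/
def pullbackSubmodule {ι Z : Type*} [NormedAddCommGroup Z] [NormedSpace ℝ Z] (A : ι → Set ℕ)
    (φ : ι → Z →L[ℝ] ℝ) : Submodule ℝ (Z × (ℕ →ᵇ ℝ)) where
  carrier := {p | (∀ a, Tendsto p.2 (cofinite ⊓ 𝓟 (A a)) (𝓝 (φ a p.1))) ∧
    ∀ ε > 0, ∃ E : Finset ι, ∀ᶠ k in cofinite, (∀ a ∈ E, k ∉ A a) → |p.2 k| ≤ ε}
  add_mem' := by
    classical
    rintro ⟨f, g⟩ ⟨f', g'⟩ ⟨h1, h2⟩ ⟨h1', h2'⟩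
    refine ⟨fun a => by rw [Prod.mk_add_mk, map_add]; exact (h1 a).add (h1' a), fun ε hε => ?_⟩
    obtain ⟨E, hE⟩ := h2 (ε / 2) (by positivity)
    obtain ⟨E', hE'⟩ := h2' (ε / 2) (by positivity)
    refine ⟨E ∪ E', ?_⟩
    filter_upwards [hE, hE'] with k hk hk' h
    have a1 := hk fun a ha => h a (Finset.mem_union_left _ ha)
    have a2 := hk' fun a ha => h a (Finset.mem_union_right _ ha)
    have := abs_add_le (g k) (g' k)
    simp only [Prod.mk_add_mk, BoundedContinuousFunction.coe_add, Pi.add_apply]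
    linarith
  zero_mem' := ⟨fun a => by rw [Prod.fst_zero, map_zero]; exact tendsto_const_nhds, fun ε hε => ⟨∅, by simp [hε.le]⟩⟩
  smul_mem' := by
    rintro c ⟨f, g⟩ ⟨h1, h2⟩
    refine ⟨fun a => by simpa using (h1 a).const_mul c, fun ε hε => ?_⟩
    obtain ⟨E, hE⟩ := h2 (ε / (|c| + 1)) (by positivity)
    refine ⟨E, ?_⟩
    filter_upwards [hE] with k hk h
    have a1 := hk h
    rw [le_div_iff₀ (by positivity)] at a1
    simp only [Prod.smul_mk, BoundedContinuousFunction.coe_smul, smul_eq_mul, abs_mul]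
    nlinarith [abs_nonneg (g k)]

theorem isClosed_pullbackSubmodule {ι Z : Type*} [NormedAddCommGroup Z] [NormedSpace ℝ Z]
    (A : ι → Set ℕ) (φ : ι → Z →L[ℝ] ℝ) :
    IsClosed (pullbackSubmodule A φ : Set (Z × (ℕ →ᵇ ℝ))) := by
  rw [← isSeqClosed_iff_isClosed]
  intro p q hp hq
  have hf : Tendsto (fun n => (p n).1) atTop (𝓝 q.1) := (continuous_fst.tendsto _).comp hq
  have hg : Tendsto (fun n => (p n).2) atTop (𝓝 q.2) := (continuous_snd.tendsto _).comp hq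
  have hg' := BoundedContinuousFunction.tendsto_iff_tendstoUniformly.1 hg
  refine ⟨fun a => ?_, fun ε hε => ?_⟩
  · exact (hg'.tendstoUniformlyOnFilter.mono_right le_top).tendsto_of_eventually_tendsto
      (Eventually.of_forall fun n => (hp n).1 a) (((φ a).continuous.tendsto _).comp hf)
  · obtain ⟨n, hn⟩ := (Metric.tendstoUniformly_iff.1 hg' (ε / 2) (by positivity)).exists
    obtain ⟨E, hE⟩ := (hp n).2 (ε / 2) (by positivity)
    refine ⟨E, ?_⟩
    filter_upwards [hE] with k hk h
    have h1 := hk h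
    have h2 := hn k
    rw [Real.dist_eq] at h2
    have := abs_add_le (q.2 k - (p n).2 k) ((p n).2 k)
    rw [sub_add_cancel] at this
    linarith

/-- This identifies the kernel of the projection to `Z` with `c₀`: off finitely many `A a` the
function is already small, and along each of these it tends to `0`. -/
theorem zero_mk_mem_pullbackSubmodule_iff {ι Z : Type*} [NormedAddCommGroup Z] [NormedSpace ℝ Z]
    (A : ι → Set ℕ) (φ : ι → Z →L[ℝ] ℝ) (g : ℕ →ᵇ ℝ) :
    ((0 : Z), g) ∈ pullbackSubmodule A φ ↔ Tendsto g cofinite (𝓝 0) := by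
  constructor
  · rintro ⟨h1, h2⟩
    refine Metric.tendsto_nhds.2 fun ε hε => ?_
    obtain ⟨E, hE⟩ := h2 (ε / 2) (by positivity)
    have h3 : ∀ᶠ k in cofinite, ∀ a ∈ E, k ∈ A a → dist (g k) 0 < ε := by
      rw [eventually_all_finset]
      intro a _
      have := Metric.tendsto_nhds.1 (h1 a) ε hε
      rw [eventually_inf_principal] at this
      simpa using this
    filter_upwards [hE, h3] with k hk hk'
    by_cases h : ∀ a ∈ E, k ∉ A a
    · have := hk h
      rw [dist_zero_right, Real.norm_eq_abs]
      linarith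
    · push Not at h
      obtain ⟨a, ha, hka⟩ := h
      exact hk' a ha hka
  · intro h
    refine ⟨fun a => by simpa using h.mono_left inf_le_left, fun ε hε => ⟨∅, ?_⟩⟩
    filter_upwards [Metric.tendsto_nhds.1 h ε hε] with k hk _
    rw [dist_zero_right, Real.norm_eq_abs] at hk
    exact hk.le

/-- A null family of coefficients on an almost disjoint family is realized by a bounded
function. -/
theorem exists_bounded_of_almostDisjoint {ι : Type*} (A : ι → Set ℕ)
    (hA : ∀ a b, a ≠ b → (A a ∩ A b).Finite) (c : ι → ℝ) (hc : Tendsto c cofinite (𝓝 0)) :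
    ∃ g : ℕ →ᵇ ℝ, (∀ a, Tendsto g (cofinite ⊓ 𝓟 (A a)) (𝓝 (c a))) ∧
      ∀ ε > 0, ∃ E : Finset ι, ∀ k, (∀ a ∈ E, k ∉ A a) → |g k| ≤ ε := by
  classical
  have hfin : ∀ ε > 0, {a | ε ≤ |c a|}.Finite := fun ε hε => by
    have := Metric.tendsto_nhds.1 hc ε hε
    rw [eventually_cofinite] at this
    simpa using this
  obtain ⟨M, hM⟩ : ∃ M, ∀ a, |c a| ≤ M := by
    obtain ⟨M, hM⟩ := ((hfin 1 one_pos).image fun a => |c a|).bddAbove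
    refine ⟨max M 1, fun a => ?_⟩
    by_cases h : 1 ≤ |c a|
    · exact le_max_of_le_left (hM ⟨a, h, rfl⟩)
    · exact le_max_of_le_right (not_le.1 h).le
  have hM0 : 0 ≤ max M 0 := le_max_right _ _
  -- at `k`, take the largest coefficient among the sets that contain `k`
  have key : ∀ k, ∃ y : ℝ, (y = 0 ∨ ∃ a, k ∈ A a ∧ y = c a) ∧ ∀ a, k ∈ A a → |c a| ≤ |y| := by
    intro k
    by_cases h : ∀ a, k ∈ A a → c a = 0
    · exact ⟨0, Or.inl rfl, fun a ha => by simp [h a ha]⟩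
    · push Not at h
      obtain ⟨b, hb, hb0⟩ := h
      -- The point `k` may lie in infinitely many `A a`, but only finitely many coefficients are at
      -- least `|c b| > 0` in absolute value, so the maximum exists.
      obtain ⟨a, ha, hmax⟩ := Set.exists_max_image ({a | |c b| ≤ |c a|} ∩ {a | k ∈ A a})
        (fun a => |c a|) ((hfin _ (abs_pos.2 hb0)).inter_of_left _) ⟨b, le_refl |c b|, hb⟩
      refine ⟨c a, Or.inr ⟨a, ha.2, rfl⟩, fun a' ha' => ?_⟩
      by_cases h' : |c b| ≤ |c a'|
      · exact hmax a' ⟨h', ha'⟩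
      · exact (not_le.1 h').le.trans ha.1
  choose y hy hymax using key
  have hyM : ∀ k, ‖y k‖ ≤ max M 0 := fun k => by
    rcases hy k with h | ⟨a, _, h⟩
    · simp [h]
    · rw [h]; exact le_max_of_le_left (hM a)
  have hsmall : ∀ ε > 0, ∃ E : Finset ι, (∀ a ∉ E, |c a| ≤ ε) ∧
      ∀ k, (∀ a ∈ E, k ∉ A a) → |y k| ≤ ε := by
    intro ε hε
    refine ⟨(hfin ε hε).toFinset, fun a ha => ?_, fun k hk => ?_⟩
    · simp at ha; exact ha.le
    · rcases hy k with h | ⟨a, ha, h⟩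
      · simp [h, hε.le]
      · rw [h]
        by_contra hlt
        exact hk a (by simpa using (not_le.1 hlt).le) ha
  refine ⟨BoundedContinuousFunction.ofNormedAddCommGroup y continuous_of_discreteTopology _ hyM,
    fun a => ?_, fun ε hε => ?_⟩
  · refine Metric.tendsto_nhds.2 fun ε hε => ?_
    rw [eventually_inf_principal]
    simp only [BoundedContinuousFunction.coe_ofNormedAddCommGroup]
    -- If `c a ≠ 0`, only finitely many other coefficients can compete with it, so the function
    -- equals `c a` on almost all of `A a`. For `c a = 0` there is no such threshold, and `ε / 2`
    -- replaces it.
    by_cases hca : c a = 0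
    · obtain ⟨E, hE, hE'⟩ := hsmall (ε / 2) (by positivity)
      have : ∀ᶠ k in cofinite, ∀ b ∈ E.erase a, ¬ (k ∈ A a ∩ A b) := by
        rw [eventually_all_finset]
        intro b hb
        exact (hA a b (Finset.ne_of_mem_erase hb).symm).eventually_cofinite_notMem
      filter_upwards [this] with k hk hka
      rw [hca, dist_zero_right, Real.norm_eq_abs]
      rcases hy k with h | ⟨b, hb, h⟩
      · simpa [h] using hε
      · rw [h]
        by_cases hba : b = a
        · simpa [hba, hca] using hε
        · have : b ∉ E := fun hbE => hk b (Finset.mem_erase.2 ⟨hba, hbE⟩) ⟨hka, hb⟩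
          have := hE b this
          linarith
    · have : ∀ᶠ k in cofinite, ∀ b ∈ (hfin _ (abs_pos.2 hca)).toFinset.erase a,
          ¬ (k ∈ A a ∩ A b) := by
        rw [eventually_all_finset]
        intro b hb
        exact (hA a b (Finset.ne_of_mem_erase hb).symm).eventually_cofinite_notMem
      filter_upwards [this] with k hk hka
      have hmax := hymax k a hka
      rcases hy k with h | ⟨b, hb, h⟩
      · rw [h, abs_zero] at hmax
        exact absurd (abs_nonpos_iff.1 hmax) hca
      · rw [h] at hmax ⊢
        by_cases hba : b = a
        · simpa [hba] using hε
        · exact absurd ⟨hka, hb⟩ (hk b (Finset.mem_erase.2 ⟨hba, by simpa using hmax⟩))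
  · obtain ⟨E, -, hE⟩ := hsmall ε hε
    exact ⟨E, hE⟩

/-- The projection `p = id - j ∘ r` kills `ker q`, so `p ∘ σ` does not depend on the section `σ` of
`q`. An algebraic `σ` supplies linearity, and preimages of controlled norm from the open mapping
theorem supply the bound. -/
theorem ExtEqZero.exists_bounded_section {Z : Type u} {Y : Type v} [NormedAddCommGroup Z]
    [NormedSpace ℝ Z] [CompleteSpace Z] [NormedAddCommGroup Y] [NormedSpace ℝ Y]
    (h : ExtEqZero Z Y) (X : Type (max u v)) [NormedAddCommGroup X] [NormedSpace ℝ X]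
    [CompleteSpace X] (j : Y →L[ℝ] X) (q : X →L[ℝ] Z) (hj : Function.Injective j)
    (hq : Function.Surjective q) (hjq : ∀ x : X, q x = 0 ↔ x ∈ Set.range j) :
    ∃ (σ : Z →ₗ[ℝ] X) (M : ℝ), (∀ z, q (σ z) = z) ∧ ∀ z, ‖σ z‖ ≤ M * ‖z‖ := by
  obtain ⟨r, hr⟩ := h X j q hj hq hjq
  let p : X →L[ℝ] X := ContinuousLinearMap.id ℝ X - j.comp r
  have hp : ∀ x y, q x = q y → p x = p y := fun x y hxy => by
    obtain ⟨w, hw⟩ := (hjq (x - y)).1 (by rw [map_sub, hxy, sub_self])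
    rw [← sub_eq_zero, ← map_sub, ← hw]
    simp [p, hr]
  have hqp : ∀ x, q (p x) = q x := fun x => by
    have : q (j (r x)) = 0 := (hjq _).2 ⟨_, rfl⟩
    simp [p, this]
  obtain ⟨σ, hσ⟩ := (q : X →ₗ[ℝ] Z).exists_rightInverse_of_surjective
    (LinearMap.range_eq_top.2 hq)
  have hσ' : ∀ z, q (σ z) = z := fun z => LinearMap.congr_fun hσ z
  obtain ⟨C, hC0, hC⟩ := q.exists_preimage_norm_le hq
  refine ⟨(p : X →ₗ[ℝ] X) ∘ₗ σ, ‖p‖ * C, fun z => (hqp _).trans (hσ' z), fun z => ?_⟩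
  obtain ⟨x, hx, hxn⟩ := hC z
  have : p (σ z) = p x := hp _ _ (by rw [hσ', hx])
  calc ‖p (σ z)‖ = ‖p x‖ := by rw [this]
    _ ≤ ‖p‖ * ‖x‖ := p.le_opNorm x
    _ ≤ ‖p‖ * (C * ‖z‖) := by gcongr
    _ = _ := by ring

/-- The lift is the second coordinate of a bounded section of the twisted sum `pullbackSubmodule A
φ`; `exists_bounded_of_almostDisjoint` makes its projection to `Z` surjective. -/
theorem exists_lift_of_extEqZero {ι : Type v} {Z : Type u} [NormedAddCommGroup Z] [NormedSpace ℝ Z]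
    [CompleteSpace Z] (hZ : ExtEqZero Z C₀(ℕ, ℝ)) (A : ι → Set ℕ)
    (hA : ∀ a b, a ≠ b → (A a ∩ A b).Finite) (φ : ι → Z →L[ℝ] ℝ)
    (hφ : ∀ f, Tendsto (fun a => φ a f) cofinite (𝓝 0)) :
    ∃ (s : Z →ₗ[ℝ] (ℕ →ᵇ ℝ)) (M : ℝ), (∀ f, ‖s f‖ ≤ M * ‖f‖) ∧
      ∀ f a, Tendsto (s f) (cofinite ⊓ 𝓟 (A a)) (𝓝 (φ a f)) := by
  set X := pullbackSubmodule A φ with hX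
  have : CompleteSpace X := (isClosed_pullbackSubmodule A φ).completeSpace_coe
  let j₀ : C₀(ℕ, ℝ) →ₗ[ℝ] X :=
    { toFun := fun g => ⟨(0, g.toBCF), (zero_mk_mem_pullbackSubmodule_iff A φ _).2 (by
        have := g.zero_at_infty'
        rwa [cocompact_eq_cofinite] at this)⟩
      map_add' := fun g g' => by ext <;> simp
      map_smul' := fun c g => by ext <;> simp }
  let j : C₀(ℕ, ℝ) →L[ℝ] X := ⟨j₀, (continuous_const.prodMk
    (ZeroAtInftyContinuousMap.isometry_toBCF (α := ℕ) (β := ℝ)).continuous).subtype_mk _⟩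
  let q : X →L[ℝ] Z := (ContinuousLinearMap.fst ℝ Z (ℕ →ᵇ ℝ)).comp X.subtypeL
  have hq : Function.Surjective q := fun f => by
    obtain ⟨g, h1, h2⟩ := exists_bounded_of_almostDisjoint A hA (fun a => φ a f) (hφ f)
    exact ⟨⟨(f, g), h1, fun ε hε => (h2 ε hε).imp fun E hE => Eventually.of_forall hE⟩, rfl⟩
  have hj : Function.Injective j := fun g g' h => by
    have : g.toBCF = g'.toBCF := congrArg (fun x : X => x.1.2) h
    ext k
    exact DFunLike.congr_fun this k
  have hjq : ∀ x : X, q x = 0 ↔ x ∈ Set.range j := by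
    rintro ⟨⟨f, g⟩, hx⟩
    constructor
    · intro h
      obtain rfl : f = 0 := h
      have hg := (zero_mk_mem_pullbackSubmodule_iff A φ _).1 hx
      refine ⟨⟨⟨g, g.continuous⟩, by rwa [cocompact_eq_cofinite]⟩, ?_⟩
      apply Subtype.ext
      refine Prod.ext rfl ?_
      ext k
      rfl
    · rintro ⟨y, hy⟩
      rw [← hy]
      rfl
  obtain ⟨σ, M, hσ, hM⟩ := hZ.exists_bounded_section X j q hj hq hjq
  refine ⟨(LinearMap.snd ℝ Z (ℕ →ᵇ ℝ)) ∘ₗ X.subtype ∘ₗ σ, M,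
    fun f => (norm_snd_le (σ f).1).trans (hM f), fun f a => ?_⟩
  have h := (σ f).2.1 a
  have h' : (σ f).1.1 = f := hσ f
  rw [h'] at h
  exact h

/-! ### Countable almost disjoint families are separated -/

theorem familiesSeparated_two_of_countable {𝒜 : Set (Set ℕ)} (h𝒜 : IsAlmostDisjointFamily 𝒜)
    (hc : 𝒜.Countable) {P : Fin 2 → Set (Set ℕ)} (hd : ∀ i j, i ≠ j → Disjoint (P i) (P j))
    (hP : ∀ i, P i ⊆ 𝒜) : FamiliesSeparated P := by
  classical
  obtain ⟨e, he⟩ := Set.countable_iff_exists_injOn.1 hc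
  have hfin : ∀ m, {A ∈ 𝒜 | e A ≤ m}.Finite := fun m =>
    Set.Finite.of_injOn (f := e) (t := Set.Iic m) (fun A hA => hA.2)
      (he.mono fun A hA => hA.1) (Set.finite_Iic m)
  have hne : ∀ A ∈ P 0, ∀ B ∈ P 1, (A ∩ B).Finite := fun A hA B hB =>
    h𝒜.2 A (hP 0 hA) B (hP 1 hB) fun h =>
      Set.disjoint_left.1 (hd 0 1 (by decide)) hA (h ▸ hB)
  -- Each `A` gives up only its intersections with the finitely many `B` enumerated no later, and
  -- each `B` meets `S` only inside the finitely many `A` enumerated before it.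
  set S : Set ℕ := {k | ∃ A ∈ P 0, k ∈ A ∧ ∀ B ∈ P 1, e B ≤ e A → k ∉ B} with hS
  refine ⟨![S, Sᶜ], ?_, ?_⟩
  · ext k
    simp [Set.mem_iInter, Fin.forall_fin_two]
  · refine Fin.forall_fin_two.2 ⟨fun A hA => ?_, fun B hB => ?_⟩
    · refine Set.Finite.subset (Set.Finite.biUnion (hfin (e A))
        (t := fun B => if B ∈ P 1 then A ∩ B else ∅) fun B _ => ?_) fun k hk => ?_
      · split_ifs with h
        exacts [hne A hA B h, Set.finite_empty]
      · have : ¬ ∀ B ∈ P 1, e B ≤ e A → k ∉ B := fun h => hk.2 ⟨A, hA, hk.1, h⟩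
        push Not at this
        obtain ⟨B, hB, hBA, hkB⟩ := this
        simp only [Set.mem_iUnion]
        exact ⟨B, ⟨hP 1 hB, hBA⟩, by simp [hB, hk.1, hkB]⟩
    · refine Set.Finite.subset (Set.Finite.biUnion (hfin (e B))
        (t := fun A => if A ∈ P 0 then A ∩ B else ∅) fun A _ => ?_) fun k hk => ?_
      · split_ifs with h
        exacts [hne A h B hB, Set.finite_empty]
      · have hkS : k ∈ S := by simpa using hk.2
        obtain ⟨A, hA, hkA, h⟩ := hkS
        simp only [Set.mem_iUnion]
        refine ⟨A, ⟨hP 0 hA, ?_⟩, by simp [hA, hk.1, hkA]⟩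
        by_contra hlt
        exact h B hB (not_le.1 hlt).le hk.1

/-! ### Unseparated families of branches -/

/-- A code for the initial segment of length `k` of `x`. -/
def segmentCode (x : ℕ → Bool) (k : ℕ) : ℕ := Encodable.encode ((List.range k).map x)

theorem segmentCode_eq_iff {x y : ℕ → Bool} {k l : ℕ} :
    segmentCode x k = segmentCode y l ↔ k = l ∧ ∀ i < k, x i = y i := by
  rw [segmentCode, segmentCode, Encodable.encode_inj]
  constructor
  · intro h
    have hkl : k = l := by simpa using congrArg List.length h
    subst hkl
    exact ⟨rfl, by simpa using h⟩
  · rintro ⟨rfl, h⟩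
    simpa using h

theorem segmentCode_injective (x : ℕ → Bool) : Function.Injective (segmentCode x) :=
  fun _ _ h => (segmentCode_eq_iff.1 h).1

/-- The `i`-th unit word of length `n` occurs in `x` at the position `k`. -/
def UnitWordAt (n i : ℕ) (x : ℕ → Bool) (k : ℕ) : Prop := ∀ t < n, x (k + t) = decide (t = i)

/-- The codes of the initial segments of `x` that are followed by the `i`-th unit word. -/
def branchSet (n i : ℕ) (x : ℕ → Bool) : Set ℕ := segmentCode x '' {k | UnitWordAt n i x k}

/-- Distinct branches share only the segments up to their first difference; on one branch, two
different unit words cannot occur at the same position. -/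
theorem finite_branchSet_inter {n : ℕ} {i j : Fin n} {x y : ℕ → Bool} (h : (i, x) ≠ (j, y)) :
    (branchSet n i x ∩ branchSet n j y).Finite := by
  by_cases hxy : x = y
  · subst hxy
    have hij : i ≠ j := fun hij => h (by rw [hij])
    convert Set.finite_empty
    rw [Set.eq_empty_iff_forall_notMem]
    rintro _ ⟨⟨k, hk, rfl⟩, l, hl, hkl⟩
    obtain rfl := segmentCode_injective x hkl
    have h1 := hk i i.2
    have h2 := hl i i.2
    rw [h1] at h2
    simp [Fin.val_inj, hij] at h2
  · obtain ⟨m, hm⟩ := Function.ne_iff.1 hxy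
    refine ((Set.finite_Iic m).image (segmentCode x)).subset ?_
    rintro _ ⟨⟨k, hk, rfl⟩, l, hl, hkl⟩
    refine ⟨k, ?_, rfl⟩
    by_contra hlt
    obtain ⟨rfl, h'⟩ := segmentCode_eq_iff.1 hkl
    exact hm (h' m (not_le.1 hlt)).symm

/-! ### Cylinders in the Cantor set -/

open PiNat in
theorem cantorMeasure_cylinder (x : ℕ → Bool) (n : ℕ) :
    cantorMeasure (cylinder x n) = (2⁻¹ : ENNReal) ^ n := by
  have h : cylinder x n = Set.pi (Finset.range n) fun i => {x i} := by
    ext y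
    simp [PiNat.cylinder, Set.mem_pi]
  rw [h, cantorMeasure, Measure.infinitePi_pi _ (fun i _ => measurableSet_singleton _)]
  simp

instance : IsProbabilityMeasure cantorMeasure := by
  unfold cantorMeasure; infer_instance

open PiNat in
/-- A set that is determined by the first `k` coordinates is cut down by the factor `1 - 2⁻ⁿ` if
a word of length `n`, depending on the first `k` coordinates only, is forbidden at `k`. -/
theorem cantorMeasure_sdiff_le {D B : Set (ℕ → Bool)} {k n : ℕ}
    (hD : ∀ x ∈ D, cylinder x k ⊆ D)
    (hB : ∀ x, ∃ y ∈ cylinder x k, cylinder y (k + n) ⊆ B) :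
    cantorMeasure (D \ B) ≤ (1 - (2⁻¹ : ENNReal) ^ n) * cantorMeasure D := by
  classical
  let ext : (Fin k → Bool) → ℕ → Bool := fun s i => if h : i < k then s ⟨i, h⟩ else false
  have hext : ∀ x : ℕ → Bool, x ∈ cylinder (ext fun i => x i) k := fun x i hi => by simp [ext, hi]
  have hmeas : ∀ (x : ℕ → Bool) m, MeasurableSet (cylinder x m) := fun x m =>
    (isOpen_cylinder _ x m).measurableSet
  have hext_eq : ∀ s x, x ∈ cylinder (ext s) k → s = fun i : Fin k => x i := fun s x hx => by
    funext i
    rw [hx i i.2]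
    simp [ext]
  set T : Finset (Fin k → Bool) := Finset.univ.filter fun s => cylinder (ext s) k ⊆ D with hT
  have hDT : D = ⋃ s ∈ T, cylinder (ext s) k := by
    ext x
    simp only [Set.mem_iUnion]
    constructor
    · intro hx
      refine ⟨fun i => x i, ?_, hext x⟩
      rw [hT, Finset.mem_filter]
      refine ⟨Finset.mem_univ _, ?_⟩
      rw [← mem_cylinder_iff_eq.1 (hext x)]
      exact hD x hx
    · rintro ⟨s, hs, hxs⟩
      exact (Finset.mem_filter.1 hs).2 hxs
  have hμD : cantorMeasure D = ∑ s ∈ T, cantorMeasure (cylinder (ext s) k) := by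
    rw [hDT, measure_biUnion_finset _ fun s _ => hmeas _ _]
    intro s _ s' _ hss
    refine Set.disjoint_left.2 fun x hx hx' => hss ?_
    rw [hext_eq s x hx, hext_eq s' x hx']
  rw [hμD, Finset.mul_sum]
  -- Each cylinder of length `k` in `D` loses a subcylinder of length `k + n`, that is, the fraction
  -- `2⁻ⁿ` of its measure.
  choose y hy hyB using hB
  calc cantorMeasure (D \ B)
      ≤ cantorMeasure (⋃ s ∈ T, cylinder (ext s) k \ cylinder (y (ext s)) (k + n)) := by
        refine measure_mono ?_
        rintro x ⟨hx, hxB⟩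
        rw [hDT] at hx
        simp only [Set.mem_iUnion] at hx ⊢
        obtain ⟨s, hs, hxs⟩ := hx
        exact ⟨s, hs, hxs, fun h => hxB (hyB _ h)⟩
    _ ≤ ∑ s ∈ T, cantorMeasure (cylinder (ext s) k \ cylinder (y (ext s)) (k + n)) :=
        measure_biUnion_finset_le _ _
    _ ≤ _ := by
        refine Finset.sum_le_sum fun s _ => ?_
        rw [measure_sdiff _ (hmeas _ _).nullMeasurableSet (measure_ne_top _ _),
          cantorMeasure_cylinder, cantorMeasure_cylinder,
          ENNReal.sub_mul (fun _ _ => by finiteness), one_mul, pow_add, mul_comm]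
        rw [← mem_cylinder_iff_eq.1 (hy (ext s))]
        exact cylinder_anti _ (Nat.le_add_right _ _)

/-- The points in which no predicted unit word occurs from the position `j` on. -/
def avoidingSet (n : ℕ) (w : ℕ → Fin n) (j : ℕ) : Set (ℕ → Bool) :=
  {x | ∀ k ≥ j, ¬ UnitWordAt n (w (segmentCode x k)) x k}

theorem unitWordAt_congr {n : ℕ} (w : ℕ → Fin n) {x y : ℕ → Bool} {k : ℕ}
    (h : ∀ i < k + n, x i = y i) :
    UnitWordAt n (w (segmentCode x k)) x k ↔ UnitWordAt n (w (segmentCode y k)) y k := by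
  have h1 : segmentCode x k = segmentCode y k :=
    segmentCode_eq_iff.2 ⟨rfl, fun i hi => h i (by omega)⟩
  rw [h1]
  exact forall₂_congr fun t ht => by rw [h (k + t) (by omega)]

theorem isClosed_avoidingSet (n : ℕ) (w : ℕ → Fin n) (j : ℕ) : IsClosed (avoidingSet n w j) := by
  rw [← isOpen_compl_iff, (PiNat.isTopologicalBasis_cylinders fun _ : ℕ => Bool).isOpen_iff]
  intro x hx
  simp only [avoidingSet, Set.mem_compl_iff, Set.mem_ofPred_eq, not_forall, not_not] at hx
  obtain ⟨k, hk, h⟩ := hx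
  refine ⟨_, ⟨x, k + n, rfl⟩, PiNat.self_mem_cylinder _ _, fun y hy hy' => hy' k hk ?_⟩
  rwa [unitWordAt_congr w fun i hi => hy i hi]

theorem cantorMeasure_avoidingSet (n : ℕ) (w : ℕ → Fin n) (j : ℕ) :
    cantorMeasure (avoidingSet n w j) = 0 := by
  -- Testing only at the positions `j + t * n` makes the tested blocks disjoint, so each test
  -- contributes a factor `1 - 2⁻ⁿ`.
  let D : ℕ → Set (ℕ → Bool) := fun N =>
    {x | ∀ t < N, ¬ UnitWordAt n (w (segmentCode x (j + t * n))) x (j + t * n)}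
  have hD : ∀ N, cantorMeasure (D N) ≤ (1 - (2⁻¹ : ENNReal) ^ n) ^ N := by
    intro N
    induction N with
    | zero => simpa using prob_le_one
    | succ N ih =>
      have h : D (N + 1) =
          D N \ {x | UnitWordAt n (w (segmentCode x (j + N * n))) x (j + N * n)} := by
        ext x
        simp only [D, Set.mem_ofPred_eq, Set.mem_sdiff, Nat.lt_succ_iff_lt_or_eq]
        constructor
        · exact fun h => ⟨fun t ht => h t (Or.inl ht), h N (Or.inr rfl)⟩
        · rintro ⟨h1, h2⟩ t (ht | rfl)
          exacts [h1 t ht, h2]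
      rw [h, pow_succ']
      refine (cantorMeasure_sdiff_le (k := j + N * n) (n := n) (fun x hx y hy => ?_)
        fun x => ?_).trans (by gcongr)
      · intro t ht
        rw [unitWordAt_congr w fun i hi => hy i ?_]
        · exact hx t ht
        · have : (t + 1) * n ≤ N * n := Nat.mul_le_mul_right _ ht
          rw [add_mul] at this
          omega
      · refine ⟨fun i => if i < j + N * n then x i else
          decide (i - (j + N * n) = w (segmentCode x (j + N * n))), fun i hi => by simp [hi],
          fun z hz => ?_⟩
        have hc : segmentCode z (j + N * n) = segmentCode x (j + N * n) :=
          segmentCode_eq_iff.2 ⟨rfl, fun i hi => by rw [hz i (by omega)]; simp [hi]⟩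
        intro t ht
        rw [hc, hz _ (by omega)]
        simp
  have hlim : Tendsto (fun N => (1 - (2⁻¹ : ENNReal) ^ n) ^ N) atTop (𝓝 0) :=
    ENNReal.tendsto_pow_atTop_nhds_zero_of_lt_one
      (ENNReal.sub_lt_self ENNReal.one_ne_top one_ne_zero (by simp))
  refine le_antisymm (ge_of_tendsto' hlim fun N => (measure_mono ?_).trans (hD N)) zero_le
  exact fun x hx t _ => hx _ (by omega)

/-! ### Bounds for the cardinals `𝔞_n` -/

theorem inIdealE_of_finite {X : Set (ℕ → Bool)} (hX : X.Finite) : InIdealE X := by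
  have h : ∀ x : ℕ → Bool, cantorMeasure {x} = 0 := fun x => by
    have hlim : Tendsto (fun N => (2⁻¹ : ENNReal) ^ N) atTop (𝓝 0) :=
      ENNReal.tendsto_pow_atTop_nhds_zero_of_lt_one (by simp)
    refine le_antisymm (ge_of_tendsto' hlim fun N => ?_) zero_le
    rw [← cantorMeasure_cylinder x N]
    exact measure_mono (Set.singleton_subset_iff.2 (PiNat.self_mem_cylinder x N))
  refine ⟨fun _ => X, fun _ => ⟨hX.isClosed, ?_⟩, Set.subset_iUnion (fun _ : ℕ => X) 0⟩
  rw [← Set.biUnion_of_singleton X]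
  exact (measure_biUnion_null_iff hX.countable).2 fun x _ => h x

theorem not_inIdealE_univ : ¬ InIdealE Set.univ := by
  rintro ⟨C, hC, h⟩
  have h0 : cantorMeasure (⋃ k, C k) = 0 := measure_iUnion_null fun k => (hC k).2
  have := measure_mono_null h h0
  simp at this

theorem exists_not_inIdealE : ∃ X : Set (ℕ → Bool), ¬ InIdealE X ∧ #X = nonE :=
  csInf_mem (s := {κ : Cardinal.{0} | ∃ X : Set (ℕ → Bool), ¬ InIdealE X ∧ #X = κ})
    ⟨_, Set.univ, not_inIdealE_univ, rfl⟩

/-- Separating sets `S i` with empty intersection give a predictor `w` with `c ∉ S (w c)`. Along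
each `x ∈ X` the predicted word then occurs only finitely often, so the closed null sets
`avoidingSet n w j` cover `X`. -/
theorem exists_not_familiesSeparated_of_not_inIdealE {n : ℕ} {X : Set (ℕ → Bool)}
    (hX : ¬ InIdealE X) :
    ∃ 𝒜 : Set (Set ℕ), IsAlmostDisjointFamily 𝒜 ∧ #𝒜 ≤ #X ∧
      ∃ P : Fin n → Set (Set ℕ), (∀ i j, i ≠ j → Disjoint (P i) (P j)) ∧ (⋃ i, P i) = 𝒜 ∧
        ¬ FamiliesSeparated P := by
  have hXinf : X.Infinite := fun h => hX (inIdealE_of_finite h)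
  have : Infinite X := hXinf.to_subtype
  -- Branch sets may be finite, for instance on a constant branch; dropping these does not affect
  -- separation.
  let P : Fin n → Set (Set ℕ) := fun i => {A | A.Infinite ∧ ∃ x ∈ X, A = branchSet n i x}
  refine ⟨⋃ i, P i, ⟨fun A hA => ?_, fun A hA B hB hAB => ?_⟩, ?_, P, fun i j hij => ?_, rfl, ?_⟩
  · obtain ⟨i, hi⟩ := Set.mem_iUnion.1 hA
    exact hi.1
  · obtain ⟨i, -, x, -, rfl⟩ := Set.mem_iUnion.1 hA
    obtain ⟨j, -, y, -, rfl⟩ := Set.mem_iUnion.1 hB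
    refine finite_branchSet_inter fun h => hAB ?_
    obtain ⟨rfl, rfl⟩ := Prod.mk.inj h
    rfl
  · calc #(⋃ i, P i : Set (Set ℕ))
        ≤ #(Set.range fun p : Fin n × X => branchSet n p.1 p.2) := by
          refine mk_le_mk_of_subset (Set.iUnion_subset fun i => ?_)
          rintro _ ⟨-, x, hx, rfl⟩
          exact ⟨(i, ⟨x, hx⟩), rfl⟩
      _ ≤ #(Fin n × X) := mk_range_le
      _ = #(Fin n) * #X := by rw [mk_prod, lift_id, lift_id]
      _ ≤ ℵ₀ * #X := by gcongr; simp
      _ = #X := aleph0_mul_eq (aleph0_le_mk X)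
  · refine Set.disjoint_left.2 ?_
    rintro _ ⟨hA, x, hx, rfl⟩ ⟨-, y, hy, h⟩
    have := finite_branchSet_inter (x := x) (y := y) fun h => hij (Prod.mk.inj h).1
    rw [← h, Set.inter_self] at this
    exact hA this
  · rintro ⟨S, hS, hPS⟩
    have hw : ∀ c, ∃ i : Fin n, c ∉ S i := fun c => by
      by_contra! h
      have : c ∈ ⋂ i, S i := Set.mem_iInter.2 h
      rw [hS] at this
      exact this
    choose w hw using hw
    refine hX ⟨avoidingSet n w, fun j => ⟨isClosed_avoidingSet n w j,
      cantorMeasure_avoidingSet n w j⟩, fun x hx => ?_⟩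
    have hfin : (⋃ i : Fin n, branchSet n i x \ S i).Finite := by
      refine Set.finite_iUnion fun i => ?_
      by_cases h : (branchSet n i x).Finite
      · exact h.sdiff
      · exact hPS i _ ⟨h, x, hx, rfl⟩
    obtain ⟨m, hm⟩ := (hfin.preimage (segmentCode_injective x).injOn).bddAbove
    refine Set.mem_iUnion.2 ⟨m + 1, fun k hk h => ?_⟩
    have : k ≤ m := hm (Set.mem_iUnion.2 ⟨w (segmentCode x k), ⟨k, h, rfl⟩, hw _⟩)
    omega

theorem exists_not_familiesSeparated (n : ℕ) :
    ∃ 𝒜 : Set (Set ℕ), IsAlmostDisjointFamily 𝒜 ∧ #𝒜 = cardA n ∧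
      ∃ P : Fin n → Set (Set ℕ), (∀ i j, i ≠ j → Disjoint (P i) (P j)) ∧ (⋃ i, P i) = 𝒜 ∧
        ¬ FamiliesSeparated P := by
  obtain ⟨𝒜, h1, -, h2⟩ := exists_not_familiesSeparated_of_not_inIdealE (n := n) not_inIdealE_univ
  exact csInf_mem (s := {κ : Cardinal.{0} | ∃ 𝒜 : Set (Set ℕ), IsAlmostDisjointFamily 𝒜 ∧ #𝒜 = κ ∧
    ∃ P : Fin n → Set (Set ℕ), (∀ i j, i ≠ j → Disjoint (P i) (P j)) ∧ (⋃ i, P i) = 𝒜 ∧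
      ¬ FamiliesSeparated P}) ⟨_, 𝒜, h1, rfl, h2⟩

theorem cardA_le_nonE (n : ℕ) : cardA n ≤ nonE := by
  obtain ⟨X, hX, hXc⟩ := exists_not_inIdealE
  obtain ⟨𝒜, h1, hc, h2⟩ := exists_not_familiesSeparated_of_not_inIdealE (n := n) hX
  rw [← hXc]
  refine le_trans (csInf_le' ?_) hc
  exact ⟨𝒜, h1, rfl, h2⟩

theorem cardA_le_continuum (n : ℕ) : cardA n ≤ 𝔠 := by
  obtain ⟨𝒜, -, h, -⟩ := exists_not_familiesSeparated n
  rw [← h]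
  simpa using mk_set_le 𝒜

theorem cardA_le_cardAOmega {n : ℕ} (hn : 2 ≤ n) : cardA n ≤ cardAOmega :=
  le_ciSup (f := fun n : {n : ℕ // 2 ≤ n} => cardA n) Cardinal.bddAbove_of_small ⟨n, hn⟩

theorem aleph_one_le_cardA_two : ℵ₁ ≤ cardA 2 := by
  obtain ⟨𝒜, h𝒜, h, P, hd, hP, hs⟩ := exists_not_familiesSeparated 2
  rw [← h]
  by_contra hlt
  have hc : 𝒜.Countable := by
    rw [← le_aleph0_iff_set_countable, ← Order.lt_succ_iff, succ_aleph0]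
    exact not_le.1 hlt
  exact hs (familiesSeparated_two_of_countable h𝒜 hc hd fun i => hP ▸ Set.subset_iUnion P i)

theorem aleph_one_le_cardAOmega : ℵ₁ ≤ cardAOmega :=
  aleph_one_le_cardA_two.trans (cardA_le_cardAOmega le_rfl)

theorem cardAOmega_le_nonE : cardAOmega ≤ nonE :=
  ciSup_le' fun n => cardA_le_nonE n

theorem cardAOmega_le_continuum : cardAOmega ≤ 𝔠 :=
  ciSup_le' fun n => cardA_le_continuum n

/-! ### Nontrivial twisted sums from convergent families of points -/

theorem ContinuousMap.norm_sum_le_one_of_disjoint {K ι : Type*} [TopologicalSpace K]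
    [CompactSpace K] [Fintype ι] (V : ι → Set K) (hV : ∀ i j, i ≠ j → Disjoint (V i) (V j))
    (f : ι → C(K, ℝ)) (hf : ∀ i, ‖f i‖ ≤ 1) (hfV : ∀ i, ∀ x ∉ V i, f i x = 0) :
    ‖∑ i, f i‖ ≤ 1 := by
  refine (ContinuousMap.norm_le _ zero_le_one).2 fun x => ?_
  rw [ContinuousMap.sum_apply]
  by_cases h : ∃ i, x ∈ V i
  · obtain ⟨i, hi⟩ := h
    rw [Fintype.sum_eq_single i fun j hj => hfV j x
      (Set.disjoint_left.1 (hV i j hj.symm) hi)]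
    exact ((f i).norm_coe_le_norm x).trans (hf i)
  · push Not at h
    rw [Finset.sum_eq_zero fun i _ => hfV i x (h i), norm_zero]
    exact zero_le_one

theorem not_extEqZero_of_tendsto {K : Type u} [TopologicalSpace K] [CompactSpace K] [T2Space K]
    (h : ∀ n : ℕ, 2 ≤ n → ∃ (z : Fin n → K) (V : Fin n → Set K)
      (φ : Fin n → DiscreteOfCard (cardA n) → K), (∀ i, IsOpen (V i)) ∧
      (∀ i j, i ≠ j → Disjoint (V i) (V j)) ∧ (∀ i d, φ i d ∈ V i) ∧ (∀ i d, φ i d ≠ z i) ∧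
      ∀ i, Tendsto (φ i) cofinite (𝓝 (z i))) :
    ¬ ExtEqZero C(K, ℝ) C₀(ℕ, ℝ) := by
  intro hext
  -- The square reconciles two demands: the weights `(m + 2)⁻¹` tend to `0`, which makes the
  -- functionals weak*-null, while `(m + 2)²` of them add up to an unbounded amount.
  choose z V φ hV hVd hφV hφz hφ using fun m : ℕ => h ((m + 2) ^ 2)
    ((Nat.le_add_left 2 m).trans (Nat.le_self_pow two_ne_zero _))
  choose 𝒜 h𝒜 hcard P hPd hP hs using fun m : ℕ => exists_not_familiesSeparated ((m + 2) ^ 2)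
  have hP𝒜 : ∀ m i, P m i ⊆ 𝒜 m := fun m i => hP m ▸ Set.subset_iUnion (P m) i
  have hemb : ∀ m i, Nonempty (P m i ↪ DiscreteOfCard (cardA ((m + 2) ^ 2))) := fun m i => by
    have h1 : #(P m i) ≤ #(DiscreteOfCard (cardA ((m + 2) ^ 2))) := by
      rw [DiscreteOfCard, mk_out, ← hcard m]
      exact mk_le_mk_of_subset (hP𝒜 m i)
    exact h1
  let e := fun m i => (hemb m i).some
  let ι := Σ m : ℕ, Σ i : Fin ((m + 2) ^ 2), P m i
  -- The `m`-th family lives on the `m`-th column of `ℕ × ℕ`, so that all of them form one almost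
  -- disjoint family.
  let A : ι → Set ℕ := fun a => Nat.pair a.1 '' a.2.2
  let ψ : ι → C(K, ℝ) →L[ℝ] ℝ := fun a => ((a.1 : ℝ) + 2)⁻¹ •
    (ContinuousMap.evalCLM ℝ (φ a.1 a.2.1 (e _ _ a.2.2)) - ContinuousMap.evalCLM ℝ (z a.1 a.2.1))
  have hψ_apply : ∀ a f, ψ a f =
      ((a.1 : ℝ) + 2)⁻¹ * (f (φ a.1 a.2.1 (e _ _ a.2.2)) - f (z a.1 a.2.1)) := fun a f => rfl
  have hA : ∀ a b, a ≠ b → (A a ∩ A b).Finite := by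
    rintro ⟨m, i, B⟩ ⟨m', i', B'⟩ hab
    by_cases hm : m = m'
    · subst hm
      have hBB : (B : Set ℕ) ≠ B' := by
        intro hBB
        by_cases hi : i = i'
        · subst hi
          exact hab (by rw [Subtype.ext hBB])
        · exact Set.disjoint_left.1 (hPd m i i' hi) B.2 (hBB ▸ B'.2)
      refine (((h𝒜 m).2 B (hP𝒜 m i B.2) B' (hP𝒜 m i' B'.2) hBB).image (Nat.pair m)).subset ?_
      rintro _ ⟨⟨k, hk, rfl⟩, k', hk', hkk⟩
      obtain ⟨-, rfl⟩ := Nat.pair_eq_pair.1 hkk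
      exact ⟨_, ⟨hk, hk'⟩, rfl⟩
    · convert Set.finite_empty
      rw [Set.eq_empty_iff_forall_notMem]
      rintro _ ⟨⟨k, hk, rfl⟩, k', hk', hkk⟩
      exact hm (Nat.pair_eq_pair.1 hkk).1.symm
  have hψ : ∀ f, Tendsto (fun a => ψ a f) cofinite (𝓝 0) := fun f => by
    refine Metric.tendsto_nhds.2 fun ε hε => ?_
    rw [eventually_cofinite]
    -- For `m ≥ m₀` the weight alone makes the values small; for each of the remaining `m`,
    -- continuity of `f` at the finitely many limits `z m i` does.
    obtain ⟨m₀, hm₀⟩ := exists_nat_gt (2 * ‖f‖ / ε)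
    refine Set.Finite.subset (Set.Finite.biUnion (Set.finite_Iio m₀)
      (t := fun m => ⋃ i, (fun B => (⟨m, i, B⟩ : ι)) '' {B | ¬ dist (ψ ⟨m, i, B⟩ f) 0 < ε})
      fun m _ => Set.finite_iUnion fun i => Set.Finite.image _ ?_) ?_
    · have h1 : Tendsto (fun B => ψ ⟨m, i, B⟩ f) cofinite (𝓝 0) := by
        have h2 := (((f.continuous.tendsto _).comp
          ((hφ m i).comp (e m i).injective.tendsto_cofinite)).sub_const (f (z m i))).const_mul
          ((m : ℝ) + 2)⁻¹
        rw [sub_self, mul_zero] at h2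
        exact h2
      exact eventually_cofinite.1 (Metric.tendsto_nhds.1 h1 ε hε)
    · rintro ⟨m, i, B⟩ hB
      simp only [Set.mem_iUnion]
      refine ⟨m, ?_, i, B, hB, rfl⟩
      by_contra hm
      refine hB ?_
      have hm' : (m₀ : ℝ) ≤ m := by exact_mod_cast not_lt.1 hm
      have h1 := norm_sub_le (f (φ m i (e m i B))) (f (z m i))
      have h2 := f.norm_coe_le_norm (φ m i (e m i B))
      have h3 := f.norm_coe_le_norm (z m i)
      rw [div_lt_iff₀ hε] at hm₀
      rw [dist_zero_right, hψ_apply, norm_mul, norm_inv, Real.norm_of_nonneg (by positivity),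
        inv_mul_lt_iff₀ (by positivity)]
      nlinarith
  obtain ⟨s, M, hsM, hsA⟩ := exists_lift_of_extEqZero hext A hA ψ hψ
  obtain ⟨m, hm⟩ := exists_nat_gt (2 * |M|)
  have hm2 : (0 : ℝ) < m + 2 := by positivity
  refine hs m ⟨fun i => {k | ∃ f : C(K, ℝ), ‖f‖ ≤ 1 ∧ (∀ x ∉ V m i, f x = 0) ∧
    ((m : ℝ) + 2)⁻¹ / 2 < s f (Nat.pair m k)}, ?_, fun i B hB => ?_⟩
  · rw [Set.eq_empty_iff_forall_notMem]
    intro k hk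
    have hk' := fun i => Set.mem_iInter.1 hk i
    choose f hf1 hfV hfs using hk'
    have h1 := ContinuousMap.norm_sum_le_one_of_disjoint (V m) (hVd m) f hf1 hfV
    have h2 : ((m : ℝ) + 2) / 2 ≤ s (∑ i, f i) (Nat.pair m k) := by
      rw [map_sum, BoundedContinuousFunction.sum_apply]
      refine le_trans (le_of_eq ?_) (Finset.card_nsmul_le_sum Finset.univ _ _ fun i _ => (hfs i).le)
      simp only [Finset.card_univ, Fintype.card_fin, nsmul_eq_mul]
      push_cast
      field_simp
    have h3 := (le_abs_self _).trans ((s (∑ i, f i)).norm_coe_le_norm (Nat.pair m k))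
    have h4 := hsM (∑ i, f i)
    have h5 : M * ‖∑ i, f i‖ ≤ |M| := by
      nlinarith [le_abs_self M, abs_nonneg M, norm_nonneg (∑ i, f i)]
    linarith
  · have hdisj : Disjoint ((V m i)ᶜ ∪ {z m i}) {φ m i (e m i ⟨B, hB⟩)} := by
      rw [Set.disjoint_singleton_right]
      rintro (h' | h')
      exacts [h' (hφV m i _), hφz m i _ h']
    -- The function must vanish at `z m i` as well as off `V m i`, since the limit need not lie
    -- outside `V m i`; then `ψ` takes the full value `(m + 2)⁻¹`.
    obtain ⟨f, hf0, hf1, hf⟩ := exists_continuous_zero_one_of_isClosed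
      ((hV m i).isClosed_compl.union isClosed_singleton) isClosed_singleton hdisj
    have h1 : ψ ⟨m, i, B, hB⟩ f = ((m : ℝ) + 2)⁻¹ := by
      rw [hψ_apply]
      have h2 : f (z m i) = 0 := hf0 (Or.inr rfl)
      have h3 : f (φ m i (e m i ⟨B, hB⟩)) = 1 := hf1 rfl
      simp only [h2, h3]
      ring
    have h2 := hsA f ⟨m, i, B, hB⟩
    rw [h1] at h2
    have h3 := h2.eventually (lt_mem_nhds (half_lt_self (inv_pos.2 hm2)))
    rw [eventually_inf_principal, eventually_cofinite] at h3
    have hinj : Function.Injective (Nat.pair m) := fun k l hkl => (Nat.pair_eq_pair.1 hkl).2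
    refine (h3.preimage hinj.injOn).subset ?_
    rintro k ⟨hkB, hk⟩ h'
    refine hk ⟨f, ?_, fun x hx => hf0 (Or.inl hx), h' ⟨k, hkB, rfl⟩⟩
    refine (ContinuousMap.norm_le _ zero_le_one).2 fun x => ?_
    rw [Real.norm_of_nonneg (hf x).1]
    exact (hf x).2

theorem exists_disjoint_isOpen_of_isClosed {K ι : Type*} [TopologicalSpace K] [NormalSpace K]
    [Finite ι] (F : ι → Set K) (hF : ∀ i, IsClosed (F i))
    (hd : ∀ i j, i ≠ j → Disjoint (F i) (F j)) :
    ∃ V : ι → Set K, (∀ i, IsOpen (V i)) ∧ (∀ i j, i ≠ j → Disjoint (V i) (V j)) ∧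
      ∀ i, F i ⊆ V i := by
  have h : ∀ i j, ∃ U W : Set K, IsOpen U ∧ IsOpen W ∧ (i ≠ j → F i ⊆ U) ∧ (i ≠ j → F j ⊆ W) ∧
      (i ≠ j → Disjoint U W) := fun i j => by
    by_cases hij : i = j
    · exact ⟨∅, ∅, isOpen_empty, isOpen_empty, by simp [hij]⟩
    · obtain ⟨U, W, hU, hW, hiU, hjW, hUW⟩ := normal_separation (hF i) (hF j) (hd i j hij)
      exact ⟨U, W, hU, hW, fun _ => hiU, fun _ => hjW, fun _ => hUW⟩
  choose U W hU hW hFU hFW hUW using h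
  refine ⟨fun i => ⋂ j, ⋂ _ : i ≠ j, U i j ∩ W j i, fun i => ?_, fun i j hij => ?_, fun i => ?_⟩
  · exact isOpen_iInter_of_finite fun j => isOpen_iInter_of_finite fun _ => (hU i j).inter (hW j i)
  · refine (hUW i j hij).mono (fun x hx => ?_) fun x hx => ?_
    · exact (Set.mem_iInter₂.1 hx j hij).1
    · exact (Set.mem_iInter₂.1 hx i hij.symm).2
  · exact Set.subset_iInter₂ fun j hij => Set.subset_inter (hFU i j hij) (hFW j i hij.symm)

/-- The open sets may be replaced by pairwise disjoint closed sets that contain the limits. -/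
theorem not_extEqZero_of_isClosed {K : Type u} [TopologicalSpace K] [CompactSpace K] [T2Space K]
    (h : ∀ n : ℕ, 2 ≤ n → ∃ (z : Fin n → K) (F : Fin n → Set K)
      (φ : Fin n → DiscreteOfCard (cardA n) → K), (∀ i, IsClosed (F i)) ∧
      (∀ i j, i ≠ j → Disjoint (F i) (F j)) ∧ (∀ i d, φ i d ∈ F i) ∧ (∀ i d, φ i d ≠ z i) ∧
      ∀ i, Tendsto (φ i) cofinite (𝓝 (z i))) :
    ¬ ExtEqZero C(K, ℝ) C₀(ℕ, ℝ) := by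
  refine not_extEqZero_of_tendsto fun n hn => ?_
  obtain ⟨z, F, φ, hF, hd, hφF, hφz, hφ⟩ := h n hn
  obtain ⟨V, hV, hVd, hFV⟩ := exists_disjoint_isOpen_of_isClosed F hF hd
  exact ⟨z, V, φ, hV, hVd, fun i d => hFV i (hφF i d), hφz, hφ⟩

/-! ### Convergent families in copies of `𝔸(κ)` and in Cantor cubes -/

theorem tendsto_symm_coe_aleksandrovSpace {K : Type*} [TopologicalSpace K] {κ : Cardinal.{v}}
    {F : Set K} (e : F ≃ₜ AleksandrovSpace κ) :
    Tendsto (fun d : DiscreteOfCard κ => (e.symm (d : OnePoint _) : K)) cofinite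
      (𝓝 (e.symm OnePoint.infty : K)) := by
  have h : Tendsto ((↑) : DiscreteOfCard κ → OnePoint (DiscreteOfCard κ)) cofinite
      (𝓝 OnePoint.infty) := by
    have := OnePoint.tendsto_coe_infty (X := DiscreteOfCard κ)
    rwa [coclosedCompact_eq_cocompact, cocompact_eq_cofinite] at this
  exact ((continuous_subtype_val.comp e.symm.continuous).tendsto _).comp h

theorem symm_coe_ne_symm_infty {K : Type*} [TopologicalSpace K] {κ : Cardinal.{v}}
    {F : Set K} (e : F ≃ₜ AleksandrovSpace κ) (d : DiscreteOfCard κ) :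
    (e.symm (d : OnePoint _) : K) ≠ e.symm OnePoint.infty := fun h =>
  OnePoint.coe_ne_infty d (e.symm.injective (Subtype.ext h))

/-- A copy of `𝔸(κ)` is compact, hence closed, so it contains `z`; all its points except the one at
infinity are isolated in it. -/
theorem eq_symm_infty_of_accPt {K : Type*} [TopologicalSpace K] [T2Space K] {κ : Cardinal.{v}}
    {F : Set K} (e : F ≃ₜ AleksandrovSpace κ) {z : K} (hz : AccPt z (𝓟 F)) :
    z = e.symm OnePoint.infty := by
  have : CompactSpace F := e.symm.compactSpace
  have hF : IsClosed F := (isCompact_iff_compactSpace.2 this).isClosed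
  have hzF : z ∈ F := hF.closure_subset (mem_closure_iff_clusterPt.2 hz.clusterPt)
  rcases hx : e ⟨z, hzF⟩ with _ | d
  · have : e.symm OnePoint.infty = ⟨z, hzF⟩ := e.symm_apply_eq.2 hx.symm
    rw [this]
  · exfalso
    have h1 : IsOpen ({(d : OnePoint (DiscreteOfCard κ))} : Set (OnePoint (DiscreteOfCard κ))) := by
      have := OnePoint.isOpenEmbedding_coe.isOpenMap _ (isOpen_discrete ({d} : Set (DiscreteOfCard κ)))
      simpa using this
    obtain ⟨U, hU, hU'⟩ := isOpen_induced_iff.1 (h1.preimage e.continuous)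
    have hmem : ∀ y : F, (y : K) ∈ U ↔ (y : K) = z := fun y => by
      have : y ∈ Subtype.val ⁻¹' U ↔ e y = d := by rw [hU']; rfl
      rw [← Set.mem_preimage, this]
      constructor
      · intro h
        have := e.injective (h.trans hx.symm)
        rw [this]
      · intro h
        have : y = ⟨z, hzF⟩ := Subtype.ext h
        rw [this]
        exact hx
    obtain ⟨y, hy, hne⟩ := accPt_iff_nhds.1 hz U (hU.mem_nhds ((hmem ⟨z, hzF⟩).2 rfl))
    exact hne ((hmem ⟨y, hy.2⟩).1 hy.1)

theorem not_extEqZero_of_isEmbedding_cube {K : Type u} [TopologicalSpace K] [CompactSpace K]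
    [T2Space K] {κ : Cardinal.{v}} (hκ : Cardinal.lift.{v} cardAOmega ≤ κ)
    {f : (κ.out → Bool) → K} (hf : IsEmbedding f) : ¬ ExtEqZero C(K, ℝ) C₀(ℕ, ℝ) := by
  classical
  have hinf : ℵ₀ ≤ κ := by
    refine le_trans ?_ hκ
    rw [← lift_aleph0.{v, 0}, Cardinal.lift_le]
    exact (aleph0_le_aleph 1).trans aleph_one_le_cardAOmega
  refine not_extEqZero_of_isClosed fun n hn => ?_
  obtain ⟨g⟩ : Nonempty (Fin n ⊕ DiscreteOfCard (cardA n) ↪ κ.out) := by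
    rw [← lift_mk_le', mk_sum, mk_fin, mk_out, DiscreteOfCard, mk_out]
    simp only [lift_add, lift_natCast, Cardinal.lift_uzero]
    refine add_le_of_le hinf ((natCast_lt_aleph0 (n := n)).le.trans hinf) (le_trans ?_ hκ)
    simpa using cardA_le_cardAOmega hn
  let b : Set (Fin n ⊕ DiscreteOfCard (cardA n)) → κ.out → Bool := fun s ξ => decide (ξ ∈ g '' s)
  have hb : ∀ s a, b s (g a) = decide (a ∈ s) := fun s a => by
    simp only [b, g.injective.mem_set_image]
  -- The first `n` coordinates serve as labels: the label `i` cuts out a closed subcube, and in it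
  -- the indicators of `{inl i, inr d}` converge to that of `{inl i}`.
  refine ⟨fun i => f (b {Sum.inl i}), fun i => f '' {x | ∀ j, x (g (Sum.inl j)) = decide (j = i)},
    fun i d => f (b {Sum.inl i, Sum.inr d}), fun i => ?_, fun i j hij => ?_, fun i d => ?_,
    fun i d h => ?_, fun i => ?_⟩
  · refine (IsCompact.image (IsClosed.isCompact ?_) hf.continuous).isClosed
    rw [Set.ofPred_forall]
    exact isClosed_iInter fun j => isClosed_eq (continuous_apply _) continuous_const
  · refine (Set.disjoint_image_iff hf.injective).2 (Set.disjoint_left.2 fun x hx hx' => ?_)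
    have h1 := hx i
    have h2 := hx' i
    rw [h1] at h2
    simp [hij] at h2
  · exact ⟨_, fun j => by rw [hb]; simp, rfl⟩
  · have := congrFun (hf.injective h) (g (Sum.inr d))
    rw [hb, hb] at this
    simp at this
  · refine (hf.continuous.tendsto _).comp (tendsto_pi_nhds.2 fun ξ => ?_)
    refine tendsto_nhds_of_eventually_eq ?_
    have : {d | g (Sum.inr d) = ξ}.Finite := Set.Subsingleton.finite fun d hd d' hd' =>
      Sum.inr_injective (g.injective (Eq.trans hd hd'.symm))
    filter_upwards [this.eventually_cofinite_notMem] with d hd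
    have hd' : ¬ g (Sum.inr d) = ξ := hd
    simp only [b, Set.image_pair, Set.image_singleton, Set.mem_insert_iff, Set.mem_singleton_iff,
      Ne.symm hd', or_false]

theorem theorem8p3 (K : Type u) [TopologicalSpace K] [CompactSpace K] [T2Space K] :
    -- copies of `𝔸(𝔞_n)` whose non-isolated parts are separated by disjoint open sets
    ((∀ n : ℕ, 2 ≤ n →
        ∃ (F : Fin n → Set K) (z : Fin n → K) (V : Fin n → Set K),
          (∀ i, Nonempty (F i ≃ₜ AleksandrovSpace (cardA n))) ∧
          (∀ i, AccPt (z i) (Filter.principal (F i))) ∧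
          (∀ i, IsOpen (V i)) ∧ (∀ i j, i ≠ j → Disjoint (V i) (V j)) ∧
          (∀ i, F i \ {z i} ⊆ V i)) →
      ¬ ExtEqZero C(K, ℝ) C₀(ℕ, ℝ)) ∧
    -- pairwise disjoint copies of `𝔸(𝔞_n)`
    ((∀ n : ℕ, 2 ≤ n →
        ∃ F : Fin n → Set K,
          (∀ i, Nonempty (F i ≃ₜ AleksandrovSpace (cardA n))) ∧
          (∀ i j, i ≠ j → Disjoint (F i) (F j))) →
      ¬ ExtEqZero C(K, ℝ) C₀(ℕ, ℝ)) ∧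
    -- Cantor cubes `2^κ` with `𝔞_ω ≤ κ`
    (∀ κ : Cardinal.{v}, Cardinal.lift.{v} cardAOmega ≤ κ →
      (∃ f : (κ.out → Bool) → K, IsEmbedding f) → ¬ ExtEqZero C(K, ℝ) C₀(ℕ, ℝ)) ∧
    -- the Cantor cube `2^𝔠`
    ((∃ f : ((𝔠 : Cardinal.{0}).out → Bool) → K, IsEmbedding f) →
      ¬ ExtEqZero C(K, ℝ) C₀(ℕ, ℝ)) ∧
    -- bounds for `𝔞_ω`
    (ℵ₁ ≤ cardAOmega ∧ cardAOmega ≤ nonE) := by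
  refine ⟨fun h => not_extEqZero_of_tendsto fun n hn => ?_,
    fun h => not_extEqZero_of_isClosed fun n hn => ?_,
    fun κ hκ ⟨f, hf⟩ => not_extEqZero_of_isEmbedding_cube hκ hf,
    fun ⟨f, hf⟩ => not_extEqZero_of_isEmbedding_cube
      (by rw [Cardinal.lift_id]; exact cardAOmega_le_continuum) hf,
    aleph_one_le_cardAOmega, cardAOmega_le_nonE⟩
  · obtain ⟨F, z, V, he, hz, hV, hd, hFV⟩ := h n hn
    let e := fun i => (he i).some
    have hz' : ∀ i, z i = (e i).symm OnePoint.infty := fun i => eq_symm_infty_of_accPt (e i) (hz i)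
    have hne : ∀ i (d : DiscreteOfCard (cardA n)), ((e i).symm (d : OnePoint (DiscreteOfCard (cardA n))) : K) ≠ z i :=
      fun i d => by rw [hz' i]; exact symm_coe_ne_symm_infty (e i) d
    refine ⟨z, V, fun i d => (e i).symm (d : OnePoint (DiscreteOfCard (cardA n))), hV, hd,
      fun i d => hFV i ⟨Subtype.coe_prop _, hne i d⟩, hne, fun i => ?_⟩
    rw [hz' i]
    exact tendsto_symm_coe_aleksandrovSpace (e i)
  · obtain ⟨F, he, hd⟩ := h n hn
    let e := fun i => (he i).some
    refine ⟨fun i => (e i).symm OnePoint.infty, F,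
      fun i d => (e i).symm (d : OnePoint (DiscreteOfCard (cardA n))), fun i => ?_, hd,
      fun i d => Subtype.coe_prop _, fun i d => symm_coe_ne_symm_infty (e i) d,
      fun i => tendsto_symm_coe_aleksandrovSpace (e i)⟩
    have : CompactSpace (F i) := (e i).symm.compactSpace
    exact (isCompact_iff_compactSpace.2 this).isClosed
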